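/- For $n,p\in\mathbb N$, $A\in\mathbb R^{n\times n}$, $C\in\mathbb R^{p\times n}$, write $(A,C)$ for the system $\dot x(t)=Ax(t)$, $w(t)=Cx(t)$, $t\ge 0$. Systems $(A_1,C_1)$ and $(A_2,C_2)$ of the same sizes $n,p$ are called topologically equivalent if there is a homeomorphism $H:\mathbb R^n\to\mathbb R^n$ such that, whenever $x(t)$ is a solution of the first system with observation $w(t)$, $H(x(t))$ is a solution of the second system with the same observation $w(t)$, and, whenever $y(t)$ is a solution of the second system with observation $z(t)$, $H^{-1}(y(t))$ is a solution of the first system with the same observation $z(t)$. Let $k_{obs}(A,C)$ be the rank of the matrix with block rows $C, CA,\dots,CA^{n-1}$. For every $(A,C)$ there is a nonsingular matrix $P\in\mathbb R^{n\times n}$ with $$P^{-1}AP=\begin{bmatrix}A^0&0&0\\0&A^+&0\\0&0&A^-\end{bmatrix},\qquad CP=\begin{bmatrix}C^0&C^+&C^-\end{bmatrix},$$ where all eigenvalues of $A^0$, $A^+$, $A^-$ have zero, positive, negative real part respectively (blocks of size zero are allowed). Let $n^0(A),n^+(A),n^-(A)$ be the sizes of $A^0,A^+,A^-$, and let $k^0_{obs}(A,C)=k_{obs}(A^0,C^0)$,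 $k^+_{obs}(A,C)=k_{obs}(A^+,C^+)$, $k^-_{obs}(A,C)=k_{obs}(A^-,C^-)$, where the observability matrix of each block is formed with its own size in place of $n$ (and $k_{obs}=0$ for a block of size zero); these six numbers do not depend on the choice of $P$. If $(A_1,C_1)$ and $(A_2,C_2)$ are topologically equivalent, then $$n^0(A_1)=n^0(A_2),\quad n^+(A_1)=n^+(A_2),\quad n^-(A_1)=n^-(A_2),\quad k_{obs}(A_1,C_1)=k_{obs}(A_2,C_2),$$ $$k^0_{obs}(A_1,C_1)=k^0_{obs}(A_2,C_2),\quad k^+_{obs}(A_1,C_1)=k^+_{obs}(A_2,C_2),\quad k^-_{obs}(A_1,C_1)=k^-_{obs}(A_2,C_2).$$ In particular, $(A_1,C_1)$ is completely observable (i.e. $k_{obs}(A_1,C_1)=n$) if and only if $(A_2,C_2)$ is, and $(A_1,C_1)$ is stable (i.e. $n^-(A_1)=n$) if and only if $(A_2,C_2)$ is. -/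

import Mathlib

namespace ObservedODE

open Matrix

/-- `(x, w)` is a state/observation pair of the system `(A, C)`:
`x' (t) = A x(t)` and `w(t) = C x(t)` for all `t ≥ 0` (one-sided derivative at `t = 0`). -/
def IsTrajectory {n p : ℕ} (A : Matrix (Fin n) (Fin n) ℝ) (C : Matrix (Fin p) (Fin n) ℝ)
    (x : ℝ → Fin n → ℝ) (w : ℝ → Fin p → ℝ) : Prop :=
  (∀ t ∈ Set.Ici (0 : ℝ), HasDerivWithinAt x (A *ᵥ x t) (Set.Ici 0) t) ∧
    ∀ t ∈ Set.Ici (0 : ℝ), w t = C *ᵥ x t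

/-- The transformation `(y(t), z(t)) = (H(x(t)), w(t))` brings `(A₁, C₁)` to `(A₂, C₂)`. -/
def Brings {n p : ℕ} (H : (Fin n → ℝ) → (Fin n → ℝ))
    (A₁ : Matrix (Fin n) (Fin n) ℝ) (C₁ : Matrix (Fin p) (Fin n) ℝ)
    (A₂ : Matrix (Fin n) (Fin n) ℝ) (C₂ : Matrix (Fin p) (Fin n) ℝ) : Prop :=
  ∀ x w, IsTrajectory A₁ C₁ x w → IsTrajectory A₂ C₂ (fun t => H (x t)) w

/-- Topological equivalence of the systems `(A₁, C₁)` and `(A₂, C₂)`. -/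
def TopologicallyEquivalent {n p : ℕ}
    (A₁ : Matrix (Fin n) (Fin n) ℝ) (C₁ : Matrix (Fin p) (Fin n) ℝ)
    (A₂ : Matrix (Fin n) (Fin n) ℝ) (C₂ : Matrix (Fin p) (Fin n) ℝ) : Prop :=
  ∃ H : (Fin n → ℝ) ≃ₜ (Fin n → ℝ), Brings H A₁ C₁ A₂ C₂ ∧ Brings H.symm A₂ C₂ A₁ C₁

/-- The Kalman observability matrix, with block rows `C, C A, …, C A ^ (n - 1)`. -/
def obsMatrix {n p : ℕ} (A : Matrix (Fin n) (Fin n) ℝ) (C : Matrix (Fin p) (Fin n) ℝ) :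
    Matrix (Fin n × Fin p) (Fin n) ℝ :=
  Matrix.of fun i j => (C * A ^ (i.1 : ℕ)) i.2 j

/-- The Kalman rank of observability. -/
noncomputable def kObs {n p : ℕ} (A : Matrix (Fin n) (Fin n) ℝ)
    (C : Matrix (Fin p) (Fin n) ℝ) : ℕ :=
  (obsMatrix A C).rank

/-- The complex eigenvalues of a real square matrix. -/
def eigenvalues {n : ℕ} (A : Matrix (Fin n) (Fin n) ℝ) : Set ℂ :=
  spectrum ℂ (A.map (algebraMap ℝ ℂ))

/-- A nonsingular matrix `P` (with inverse `Q`) that transforms the system `(A, C)` into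
`(diag(A⁰, A⁺, A⁻), [C⁰ C⁺ C⁻])`, i.e. `P⁻¹ A P = diag(A⁰, A⁺, A⁻)` and `C P = [C⁰ C⁺ C⁻]`,
where the eigenvalues of `A⁰`, `A⁺`, `A⁻` have zero, positive and negative real parts
respectively. Blocks of size zero are allowed. -/
structure SpectralForm {n p : ℕ} (A : Matrix (Fin n) (Fin n) ℝ)
    (C : Matrix (Fin p) (Fin n) ℝ) where
  /-- the dimension of `A⁰` -/
  nZero : ℕ
  /-- the dimension of `A⁺` -/
  nPlus : ℕ
  /-- the dimension of `A⁻` -/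
  nMinus : ℕ
  AZero : Matrix (Fin nZero) (Fin nZero) ℝ
  APlus : Matrix (Fin nPlus) (Fin nPlus) ℝ
  AMinus : Matrix (Fin nMinus) (Fin nMinus) ℝ
  CZero : Matrix (Fin p) (Fin nZero) ℝ
  CPlus : Matrix (Fin p) (Fin nPlus) ℝ
  CMinus : Matrix (Fin p) (Fin nMinus) ℝ
  P : Matrix (Fin n) (Fin nZero ⊕ (Fin nPlus ⊕ Fin nMinus)) ℝ
  Q : Matrix (Fin nZero ⊕ (Fin nPlus ⊕ Fin nMinus)) (Fin n) ℝ
  mul_inv : P * Q = 1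
  inv_mul : Q * P = 1
  conj_eq : Q * A * P = fromBlocks AZero 0 0 (fromBlocks APlus 0 0 AMinus)
  obs_eq : C * P = fromCols CZero (fromCols CPlus CMinus)
  re_zero : ∀ μ ∈ eigenvalues AZero, μ.re = 0
  re_pos : ∀ μ ∈ eigenvalues APlus, 0 < μ.re
  re_neg : ∀ μ ∈ eigenvalues AMinus, μ.re < 0

namespace SpectralForm

variable {n p : ℕ} {A : Matrix (Fin n) (Fin n) ℝ} {C : Matrix (Fin p) (Fin n) ℝ}

/-- The Kalman rank of the subsystem `(A⁰, C⁰)`. -/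
noncomputable def kObsZero (D : SpectralForm A C) : ℕ := kObs D.AZero D.CZero

/-- The Kalman rank of the subsystem `(A⁺, C⁺)`. -/
noncomputable def kObsPlus (D : SpectralForm A C) : ℕ := kObs D.APlus D.CPlus

/-- The Kalman rank of the subsystem `(A⁻, C⁻)`. -/
noncomputable def kObsMinus (D : SpectralForm A C) : ℕ := kObs D.AMinus D.CMinus

end SpectralForm

/-- The system is completely observable: its Kalman rank is `n`. -/
def IsObservable {n p : ℕ} (A : Matrix (Fin n) (Fin n) ℝ) (C : Matrix (Fin p) (Fin n) ℝ) :
    Prop :=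
  kObs A C = n

/-- The system is stable: `n⁻(A) = n`. -/
def IsStable {n p : ℕ} (A : Matrix (Fin n) (Fin n) ℝ) (C : Matrix (Fin p) (Fin n) ℝ) : Prop :=
  ∃ D : SpectralForm A C, D.nMinus = n

end ObservedODE

/-!
An equivalence conjugates the two flows (after a translation it fixes the origin) and
intertwines the observations. Hence it maps the stable subspace, the unstable subspace (the
stable subspace of the reversed flow), the unobservable subspace and their intersections
homeomorphically onto their counterparts, and by invariance of dimension all these dimensions
agree. The spectra of `A⁰`, `A⁺` and `A⁻` being disjoint, the unobservable subspace is the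
direct sum of those of the blocks, so these dimensions determine the sizes and the Kalman ranks
of all blocks.

Invariance of dimension rests on the nonexistence of a `C¹` retraction onto a sphere. If `φ`
vanishes on the sphere, the volume of the image of the ball under `x ↦ x + t • φ x` is, for
small `t`, the volume of the ball, while `∫ det (1 + t • φ')` is a polynomial in `t`; so the
integral equals that volume at `t = 1` too, although the derivative of a retraction onto the
sphere is singular.
-/

/-! ### Invariance of dimension -/

section InvarianceOfDimension

open MeasureTheory Set Metric Polynomial Module

open scoped NNReal

theorem exists_eval_eq_integral_eval {𝕜 α : Type*} [RCLike 𝕜] [MeasurableSpace α]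
    {μ : Measure α} {q : α → 𝕜[X]} {n : ℕ} (hdeg : ∀ a, (q a).natDegree ≤ n)
    (hint : ∀ t, Integrable (fun a => (q a).eval t) μ) :
    ∃ P : 𝕜[X], ∀ t, P.eval t = ∫ a, (q a).eval t ∂μ := by
  let s := Finset.range (n + 1)
  let v : ℕ → 𝕜 := Nat.cast
  have hv : InjOn v s := Nat.cast_injective.injOn
  have hq (a : α) : q a = Lagrange.interpolate s v fun i => (q a).eval (v i) := by
    refine Lagrange.eq_interpolate hv ?_
    rw [Finset.card_range]
    exact degree_lt_iff_coeff_zero _ _ |>.2 fun m hm =>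
      coeff_eq_zero_of_natDegree_lt ((hdeg a).trans_lt hm)
  refine ⟨∑ i ∈ s, C (∫ a, (q a).eval (v i) ∂μ) * Lagrange.basis s v i, fun t => ?_⟩
  calc (∑ i ∈ s, C (∫ a, (q a).eval (v i) ∂μ) * Lagrange.basis s v i).eval t
      = ∫ a, ∑ i ∈ s, (q a).eval (v i) * (Lagrange.basis s v i).eval t ∂μ := by
        rw [integral_finsetSum _ fun i _ => (hint _).mul_const _]
        simp only [eval_finsetSum, eval_mul, eval_C, integral_mul_const]
    _ = ∫ a, (q a).eval t ∂μ := by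
        refine integral_congr_ae (.of_forall fun a => ?_)
        change _ = (q a).eval t
        conv_rhs => rw [hq a]
        simp only [Lagrange.interpolate_apply, eval_finsetSum, eval_mul, eval_C]

theorem exists_eval_eq_det_one_add_smul {K V : Type*} [Field K] [AddCommGroup V] [Module K V]
    [FiniteDimensional K V] (f : Module.End K V) :
    ∃ q : K[X], q.natDegree ≤ finrank K V ∧ ∀ t, q.eval t = LinearMap.det (1 + t • f) := by
  let b := finBasis K V
  let M := LinearMap.toMatrix b b f
  refine ⟨((X : K[X]) • M.map C + (1 : Matrix _ _ K).map C).det, ?_, fun t => ?_⟩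
  · simpa using natDegree_det_X_add_C_le M 1
  · rw [← LinearMap.det_toMatrix b, map_add, map_smul, LinearMap.toMatrix_one, eval_det]
    congr 1
    ext i j
    simp [M, Matrix.one_apply, add_comm, mul_comm t]

variable {E F : Type*} [NormedAddCommGroup E] [NormedSpace ℝ E] [NormedAddCommGroup F]

theorem lipschitzWith_indicator_closedBall {φ : E → F} {K : ℝ≥0} {r : ℝ}
    (hφ : LipschitzOnWith K φ (closedBall 0 r)) (h0 : ∀ x, ‖x‖ = r → φ x = 0) :
    LipschitzWith K ((closedBall 0 r).indicator φ) := by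
  have norm_le {x y : E} (hx : ‖x‖ ≤ r) (hy : r < ‖y‖) : ‖φ x‖ ≤ K * ‖x - y‖ := by
    have hcont : ContinuousOn (fun s : ℝ => ‖x + s • (y - x)‖) (Icc 0 1) := by fun_prop
    obtain ⟨s, hs, hsr : ‖x + s • (y - x)‖ = r⟩ :=
      intermediate_value_Icc (zero_le_one' ℝ) hcont (show r ∈ Icc _ _ by simp [hx, hy.le])
    calc ‖φ x‖ = dist (φ x) (φ (x + s • (y - x))) := by rw [h0 _ hsr, dist_zero_right]
      _ ≤ K * dist x (x + s • (y - x)) :=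
          hφ.dist_le_mul x (by simpa using hx) _ (by simp [hsr])
      _ = K * (s * ‖x - y‖) := by
          rw [dist_eq_norm, sub_add_cancel_left, norm_neg, norm_smul,
            Real.norm_of_nonneg hs.1, norm_sub_rev]
      _ ≤ K * ‖x - y‖ := by
          gcongr
          exact mul_le_of_le_one_left (norm_nonneg _) hs.2
  refine LipschitzWith.of_dist_le_mul fun x y => ?_
  by_cases hx : x ∈ closedBall (0 : E) r <;> by_cases hy : y ∈ closedBall (0 : E) r
  · simpa [indicator_of_mem hx, indicator_of_mem hy] using hφ.dist_le_mul x hx y hy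
  · rw [indicator_of_mem hx, indicator_of_notMem hy, dist_zero_right, dist_eq_norm]
    exact norm_le (by simpa using hx) (by simpa using hy)
  · rw [indicator_of_notMem hx, indicator_of_mem hy, dist_zero_left, dist_comm, dist_eq_norm]
    exact norm_le (by simpa using hy) (by simpa using hx)
  · rw [indicator_of_notMem hx, indicator_of_notMem hy, dist_self]
    positivity

theorem bijective_id_add_of_lipschitzWith [CompleteSpace E] {ψ : E → E} {K : ℝ≥0}
    (hψ : LipschitzWith K ψ) (hK : K < 1) : Function.Bijective fun x => x + ψ x := by
  rcases subsingleton_or_nontrivial E with hE | hE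
  · exact ⟨fun _ _ _ => Subsingleton.elim _ _, fun y => ⟨y, Subsingleton.elim _ _⟩⟩
  have happrox : ApproximatesLinearOn (fun x => x + ψ x)
      (ContinuousLinearEquiv.refl ℝ E : E →L[ℝ] E) univ K := fun x _ y _ => by
    simpa [add_sub_add_comm, dist_eq_norm] using hψ.dist_le_mul x y
  exact (happrox.toHomeomorph _ (.inr (by simpa using hK))).bijective

theorem bijOn_ball_id_add [CompleteSpace E] {φ : E → E} {K : ℝ≥0} {r : ℝ}
    (hφ : LipschitzOnWith K φ (closedBall 0 r)) (hK : K < 1) (h0 : ∀ x, ‖x‖ = r → φ x = 0) :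
    BijOn (fun x => x + φ x) (ball 0 r) (ball 0 r) := by
  set ψ := (closedBall (0 : E) r).indicator φ with hψ
  have hbij := bijective_id_add_of_lipschitzWith (lipschitzWith_indicator_closedBall hφ h0) hK
  have hfix {x : E} (hx : x ∉ ball (0 : E) r) : x + ψ x = x := by
    have hψx : ψ x = 0 := by
      rw [hψ, indicator_apply_eq_zero]
      exact fun hx' => h0 x (le_antisymm (by simpa using hx') (by simpa using hx))
    rw [hψx, add_zero]
  have heq : EqOn (fun x => x + ψ x) (fun x => x + φ x) (ball 0 r) := fun x hx => by
    simp only [hψ, indicator_of_mem (ball_subset_closedBall hx)]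
  refine BijOn.congr ⟨fun x hx => ?_, hbij.1.injOn, fun y hy => ?_⟩ heq
  · by_contra hy
    have hxx : x + ψ x = x := hbij.1 (hfix hy)
    exact hy (show x + ψ x ∈ ball 0 r by rwa [hxx])
  · obtain ⟨x, rfl⟩ := hbij.2 y
    refine ⟨x, ?_, rfl⟩
    by_contra hx
    exact hx ((hfix hx).symm ▸ hy)

theorem continuous_det_one_add_smul_fderiv {φ : E → E} (hφ : ContDiff ℝ 1 φ) (t : ℝ) :
    Continuous fun x => (1 + t • fderiv ℝ φ x).det :=
  ContinuousLinearMap.continuous_det.comp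
    (continuous_const.add ((hφ.continuous_fderiv one_ne_zero).const_smul t))

variable [FiniteDimensional ℝ E]

theorem det_one_add_ne_zero {M : E →L[ℝ] E} (hM : ‖M‖ < 1) : (1 + M).det ≠ 0 := by
  have hunit : IsUnit (1 + M) := by
    rw [← sub_neg_eq_add]
    exact isUnit_one_sub_of_norm_lt_one ((norm_neg M).trans_lt hM)
  have hunit' := hunit.map (ContinuousLinearMap.toLinearMapRingHom (R₁ := ℝ) (M₁ := E))
  exact ((LinearMap.isUnit_iff_isUnit_det _).1 hunit').ne_zero

theorem det_one_add_pos {M : E →L[ℝ] E} (hM : ‖M‖ < 1) : 0 < (1 + M).det := by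
  have hne : ∀ s ∈ Icc (0 : ℝ) 1, (1 + s • M).det ≠ 0 := fun s hs => by
    refine det_one_add_ne_zero ?_
    rw [norm_smul, Real.norm_of_nonneg hs.1]
    exact (mul_le_of_le_one_left (norm_nonneg _) hs.2).trans_lt hM
  have hcont : ContinuousOn (fun s : ℝ => (1 + s • M).det) (Icc 0 1) :=
    (ContinuousLinearMap.continuous_det.comp (by fun_prop)).continuousOn
  by_contra hneg
  obtain ⟨s, hs, h0⟩ := intermediate_value_Icc' (zero_le_one' ℝ) hcont
    (show (0 : ℝ) ∈ Icc _ _ from ⟨by simpa using hneg, by simp [ContinuousLinearMap.det]⟩)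
  exact hne s hs h0

section Volume

variable [MeasurableSpace E] [BorelSpace E] (μ : Measure E) [μ.IsAddHaarMeasure]

theorem setIntegral_ball_det_one_add_fderiv {φ : E → E} (hφ : ContDiff ℝ 1 φ) {K : ℝ≥0}
    {r : ℝ} (hlip : LipschitzOnWith K φ (closedBall 0 r)) (hK : K < 1)
    (h0 : ∀ x, ‖x‖ = r → φ x = 0) :
    ∫ x in ball 0 r, (1 + fderiv ℝ φ x).det ∂μ = μ.real (ball 0 r) := by
  have hpos : ∀ x ∈ ball (0 : E) r, 0 < (1 + fderiv ℝ φ x).det := fun x hx =>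
    det_one_add_pos ((norm_fderiv_le_of_lipschitzOn ℝ (closedBall_mem_nhds_of_mem hx)
      hlip).trans_lt (by exact_mod_cast hK))
  have hderiv : ∀ x ∈ ball (0 : E) r, HasFDerivWithinAt (fun x => x + φ x)
      (1 + fderiv ℝ φ x) (ball 0 r) x := fun x _ =>
    ((hasFDerivAt_id x).add (hφ.differentiable one_ne_zero x).hasFDerivAt).hasFDerivWithinAt
  have hbij := bijOn_ball_id_add hlip hK h0
  have hvol := lintegral_abs_det_fderiv_eq_addHaar_image μ measurableSet_ball hderiv hbij.injOn
  have hcont : Continuous fun x => (1 + fderiv ℝ φ x).det := by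
    simpa using continuous_det_one_add_smul_fderiv hφ 1
  rw [hbij.image_eq] at hvol
  rw [integral_eq_lintegral_of_nonneg_ae _ hcont.aestronglyMeasurable, Measure.real, ← hvol]
  · congr 1
    exact setLIntegral_congr_fun measurableSet_ball fun x hx => by
      simp only [abs_of_pos (hpos x hx)]
  · exact (ae_restrict_mem measurableSet_ball).mono fun x hx => (hpos x hx).le

theorem setIntegral_ball_det_one_add_fderiv_of_contDiff {φ : E → E} (hφ : ContDiff ℝ 1 φ)
    {r : ℝ} (h0 : ∀ x, ‖x‖ = r → φ x = 0) :
    ∫ x in ball 0 r, (1 + fderiv ℝ φ x).det ∂μ = μ.real (ball 0 r) := by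
  obtain ⟨K, hK⟩ := hφ.contDiffOn.exists_lipschitzOnWith one_ne_zero
    (convex_closedBall (0 : E) r) (isCompact_closedBall (0 : E) r)
  have hsmall : ∀ t ∈ Ioo (0 : ℝ) (1 / (K + 1)),
      ∫ x in ball 0 r, (1 + t • fderiv ℝ φ x).det ∂μ = μ.real (ball 0 r) := by
    rintro t ⟨ht0, ht1⟩
    have hlip : LipschitzOnWith (t.toNNReal * K) (t • φ) (closedBall 0 r) :=
      LipschitzOnWith.of_dist_le_mul fun x hx y hy => by
        rw [Pi.smul_apply, Pi.smul_apply, dist_smul₀, Real.norm_of_nonneg ht0.le, NNReal.coe_mul,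
          Real.coe_toNNReal t ht0.le, mul_assoc]
        exact mul_le_mul_of_nonneg_left (hK.dist_le_mul x hx y hy) ht0.le
    have hlt : t.toNNReal * K < 1 := by
      rw [lt_div_iff₀ (by positivity)] at ht1
      rw [← NNReal.coe_lt_coe, NNReal.coe_mul, Real.coe_toNNReal t ht0.le, NNReal.coe_one]
      linarith
    simpa only [fderiv_fun_const_smul (hφ.differentiable one_ne_zero _)] using
      setIntegral_ball_det_one_add_fderiv μ (hφ.const_smul t) hlip hlt fun x hx => by
        rw [h0 x hx, smul_zero]
  choose q hdeg hq using fun x => exists_eval_eq_det_one_add_smul (fderiv ℝ φ x : E →ₗ[ℝ] E)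
  have hq' (x : E) (t : ℝ) : (q x).eval t = (1 + t • fderiv ℝ φ x).det := hq x t
  have hint (t : ℝ) : IntegrableOn (fun x => (q x).eval t) (ball 0 r) μ := by
    simp only [hq']
    exact ((continuous_det_one_add_smul_fderiv hφ t).continuousOn.integrableOn_compact
      (isCompact_closedBall (0 : E) r)).mono_set ball_subset_closedBall
  obtain ⟨P, hP⟩ := exists_eval_eq_integral_eval hdeg hint
  have hPC : P = C (μ.real (ball 0 r)) := by
    refine eq_of_infinite_eval_eq _ _ ((Ioo_infinite (show (0 : ℝ) < 1 / (K + 1) by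
      positivity)).mono fun t ht => ?_)
    simpa only [mem_ofPred_eq, hP, hq', eval_C] using hsmall t ht
  simpa only [hP, hq', eval_C, one_smul] using congrArg (eval 1) hPC

end Volume

section InnerProduct

variable {E : Type*} [NormedAddCommGroup E] [InnerProductSpace ℝ E] [FiniteDimensional ℝ E]

theorem det_eq_zero_of_norm_eq_const {ρ : E → E} {R : ℝ} (hR : 0 < R) (hρ : ∀ x, ‖ρ x‖ = R)
    {ρ' : E →L[ℝ] E} {x : E} (hderiv : HasFDerivAt ρ ρ' x) : ρ'.det = 0 := by
  by_contra hdet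
  have hunit := (LinearMap.isUnit_iff_isUnit_det _).2 (isUnit_iff_ne_zero.2 hdet)
  obtain ⟨z, hz : ρ' z = ρ x⟩ := ((Module.End.isUnit_iff _).1 hunit).2 (ρ x)
  have hconst : HasFDerivAt (fun y => inner ℝ (ρ y) (ρ y)) (0 : E →L[ℝ] ℝ) x := by
    simp only [real_inner_self_eq_norm_sq, hρ]
    exact hasFDerivAt_const _ _
  have heq := DFunLike.congr_fun ((hderiv.inner ℝ hderiv).unique hconst) z
  simp [fderivInnerCLM_apply, hz, hρ, hR.ne'] at heq

theorem not_contDiff_retraction_sphere {ρ : E → E} (hρ : ContDiff ℝ 1 ρ) {R : ℝ} (hR : 0 < R)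
    (hnorm : ∀ x, ‖ρ x‖ = R) (hfix : ∀ x, ‖x‖ = R → ρ x = x) : False := by
  borelize E
  have hφ : ContDiff ℝ 1 fun x => ρ x - x := hρ.sub contDiff_id
  have hderiv (x : E) : HasFDerivAt ρ (1 + fderiv ℝ (fun x => ρ x - x) x) x :=
    ((hasFDerivAt_id x).add (hφ.differentiable one_ne_zero x).hasFDerivAt).congr_of_eventuallyEq
      (.of_forall fun y => (add_sub_cancel y (ρ y)).symm)
  have hvol := setIntegral_ball_det_one_add_fderiv_of_contDiff Measure.addHaar hφ
    fun x hx => sub_eq_zero.2 (hfix x hx)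
  simp only [det_eq_zero_of_norm_eq_const hR hnorm (hderiv _), integral_zero] at hvol
  exact (ENNReal.toReal_pos (measure_ball_pos Measure.addHaar (0 : E) hR).ne'
    measure_ball_lt_top.ne).ne hvol

theorem exists_eq_zero_of_contDiff_of_dist_lt {g : E → E} (hg : ContDiff ℝ 1 g) {ε : ℝ}
    (hε : ∀ x, dist (g x) x < ε) : ∃ x, g x = 0 := by
  by_contra! hne
  have hε0 : 0 < ε := dist_nonneg.trans_lt (hε 0)
  let χ : ContDiffBump (0 : E) := ⟨ε, 2 * ε, hε0, by linarith⟩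
  let h : E → E := fun x => x + χ x • (g x - x)
  have hh : ContDiff ℝ 1 h := contDiff_id.add (χ.contDiff.smul (hg.sub contDiff_id))
  have hh0 (x : E) : h x ≠ 0 := by
    intro hx
    by_cases hxε : ‖x‖ ≤ ε
    · have hχ : χ x = 1 := χ.one_of_mem_closedBall (by simpa [χ] using hxε)
      exact hne x (by simpa [h, hχ] using hx)
    · refine hxε ?_
      calc ‖x‖ = ‖χ x • (g x - x)‖ := by
            rw [← norm_neg (χ x • _), ← eq_neg_of_add_eq_zero_left hx]
        _ = χ x * dist (g x) x := by
            rw [norm_smul, Real.norm_of_nonneg χ.nonneg, dist_eq_norm]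
        _ ≤ ε := (mul_le_of_le_one_left dist_nonneg χ.le_one).trans (hε x).le
  refine not_contDiff_retraction_sphere (ρ := fun x => (2 * ε * ‖h x‖⁻¹) • h x)
    ((contDiff_const.mul ((hh.norm ℝ hh0).inv fun x => norm_ne_zero_iff.2 (hh0 x))).smul hh)
    (mul_pos two_pos hε0) (fun x => ?_) fun x hx => ?_
  · simp [norm_smul, hh0 x, abs_of_pos hε0]
  · have hχ : χ x = 0 := χ.zero_of_le_dist (by simp [χ, hx])
    have hhx : h x = x := by simp [h, hχ]
    rw [hhx, hx, mul_inv_cancel₀ (by positivity), one_smul]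

theorem exists_eq_zero_of_dist_lt {g : E → E} (hg : Continuous g) {ε : ℝ}
    (hε : ∀ x, dist (g x) x < ε) : ∃ x, g x = 0 := by
  by_contra! hne
  obtain ⟨g₁, hg₁, hdist, -⟩ := hg.exists_contDiff_approx (ε := fun x => min ‖g x‖ 1) 1
    (by fun_prop) (fun x => lt_min (norm_pos_iff.2 (hne x)) one_pos)
  obtain ⟨x, hx⟩ := exists_eq_zero_of_contDiff_of_dist_lt hg₁ (ε := 1 + ε) fun x =>
    (dist_triangle _ (g x) _).trans_lt
      (add_lt_add ((hdist x).trans_le (min_le_right _ _)) (hε x))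
  have hlt := (hdist x).trans_le (min_le_left _ _)
  rw [hx, dist_zero_left] at hlt
  exact hlt.false

variable [NormedSpace ℝ F] [FiniteDimensional ℝ F]

theorem finrank_le_of_homeomorph (f : E ≃ₜ F) : finrank ℝ E ≤ finrank ℝ F := by
  by_contra! hlt
  obtain ⟨G, hG, hdist, -⟩ := f.symm.continuous.exists_contDiff_approx (ε := fun _ => 1) 1
    continuous_const (fun _ => one_pos)
  -- `G ∘ f - c` stays within a bounded distance of the identity, so it would have to vanish.
  obtain ⟨c, hc⟩ := (hG.dense_compl_range_of_finrank_lt_finrank hlt).nonempty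
  obtain ⟨x, hx⟩ := exists_eq_zero_of_dist_lt (g := fun x => G (f x) - c) (ε := 1 + ‖c‖)
    ((hG.continuous.comp f.continuous).sub continuous_const) fun x => by
      have h1 := hdist (f x)
      rw [f.symm_apply_apply, dist_eq_norm] at h1
      rw [dist_eq_norm, sub_right_comm]
      linarith [norm_sub_le (G (f x) - x) c]
  exact hc ⟨f x, sub_eq_zero.1 hx⟩

end InnerProduct

theorem finrank_eq_of_homeomorph [NormedSpace ℝ F] [FiniteDimensional ℝ F] (f : E ≃ₜ F) :
    finrank ℝ E = finrank ℝ F :=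
  let e : EuclideanSpace ℝ (Fin (finrank ℝ E)) ≃L[ℝ] E := .ofFinrankEq finrank_euclideanSpace_fin
  let e' : EuclideanSpace ℝ (Fin (finrank ℝ F)) ≃L[ℝ] F := .ofFinrankEq finrank_euclideanSpace_fin
  le_antisymm
    (e.toLinearEquiv.finrank_eq ▸ finrank_le_of_homeomorph (e.toHomeomorph.trans f))
    (e'.toLinearEquiv.finrank_eq ▸ finrank_le_of_homeomorph (e'.toHomeomorph.trans f.symm))

theorem finrank_eq_of_homeomorph_mem_iff {E F : Type*} [NormedAddCommGroup E] [NormedSpace ℝ E]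
    [NormedAddCommGroup F] [NormedSpace ℝ F] {U : Submodule ℝ E} {V : Submodule ℝ F}
    [FiniteDimensional ℝ U] [FiniteDimensional ℝ V] (H : E ≃ₜ F) (hH : ∀ x, x ∈ U ↔ H x ∈ V) :
    finrank ℝ U = finrank ℝ V :=
  finrank_eq_of_homeomorph (H.subtype hH : {x // x ∈ U} ≃ₜ {y // y ∈ V})

end InvarianceOfDimension

/-! ### Linear flows and their stable subspaces -/

section Flow

open Filter Module Set

open scoped Topology Nat

variable {E F : Type*} [NormedAddCommGroup E] [NormedSpace ℝ E]
  [NormedAddCommGroup F] [NormedSpace ℝ F]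

/-- The flow `exp (t f)` of the linear differential equation `x' = f x`. -/
noncomputable def flow (f : E →L[ℝ] E) (t : ℝ) : E →L[ℝ] E :=
  NormedSpace.exp (t • f)

theorem flow_zero (f : E →L[ℝ] E) : flow f 0 = 1 := by
  rw [flow, zero_smul, NormedSpace.exp_zero]

theorem flow_neg (f : E →L[ℝ] E) (t : ℝ) : flow (-f) t = flow f (-t) := by
  rw [flow, flow, smul_neg, neg_smul]

/-- The points whose forward orbit under the flow of `f` tends to the origin. -/
noncomputable def stableSubspace (f : E →L[ℝ] E) : Submodule ℝ E where
  carrier := {x | Tendsto (fun t => flow f t x) atTop (𝓝 0)}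
  zero_mem' := by simp
  add_mem' {x y} hx hy := by
    simpa only [mem_ofPred_eq, map_add, add_zero] using hx.add hy
  smul_mem' c x hx := by
    simpa only [mem_ofPred_eq, map_smul, smul_zero] using hx.const_smul c

theorem mem_stableSubspace {f : E →L[ℝ] E} {x : E} :
    x ∈ stableSubspace f ↔ Tendsto (fun t => flow f t x) atTop (𝓝 0) :=
  Iff.rfl

theorem mem_stableSubspace_iff_of_homeomorph {f : E →L[ℝ] E} {g : F →L[ℝ] F} {H : E ≃ₜ F}
    (h0 : H 0 = 0) (hH : ∀ t x, H (flow f t x) = flow g t (H x)) {x : E} :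
    x ∈ stableSubspace f ↔ H x ∈ stableSubspace g := by
  simp only [mem_stableSubspace, H.isInducing.tendsto_nhds_iff, h0, Function.comp_def, hH]

variable [CompleteSpace E]

theorem flow_neg_apply_flow (f : E →L[ℝ] E) (t : ℝ) (x : E) : flow f (-t) (flow f t x) = x := by
  have hcomm : Commute (-t • f) (t • f) := ((Commute.refl f).smul_left _).smul_right _
  have hmul : flow f (-t) * flow f t = 1 := by
    let _ : NormedAlgebra ℚ (E →L[ℝ] E) := NormedAlgebra.restrictScalars ℚ ℝ _
    rw [flow, flow, ← NormedSpace.exp_add_of_commute hcomm, neg_smul, neg_add_cancel,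
      NormedSpace.exp_zero]
  exact DFunLike.congr_fun hmul x

theorem flow_apply_flow_neg (f : E →L[ℝ] E) (t : ℝ) (x : E) : flow f t (flow f (-t) x) = x := by
  simpa using flow_neg_apply_flow f (-t) x

theorem hasSum_flow (f : E →L[ℝ] E) (t : ℝ) (x : E) :
    HasSum (fun k : ℕ => ((k !⁻¹ : ℝ) * t ^ k) • (f ^ k) x) (flow f t x) := by
  simpa [flow, smul_pow, smul_smul] using
    ((NormedSpace.exp_series_hasSum_exp' (𝕂 := ℝ) (t • f)).mapL
      (ContinuousLinearMap.apply ℝ E x))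

theorem flow_eq_sum_of_pow_apply_eq_zero {f : E →L[ℝ] E} {k : ℕ} {x : E} (hk : (f ^ k) x = 0)
    (t : ℝ) : flow f t x = ∑ j ∈ Finset.range k, ((j !⁻¹ : ℝ) * t ^ j) • (f ^ j) x := by
  refine (hasSum_flow f t x).unique (hasSum_sum_of_ne_finset_zero fun j hj => ?_)
  obtain ⟨i, rfl⟩ := Nat.exists_eq_add_of_le' (not_lt.1 fun h => hj (Finset.mem_range.2 h))
  rw [pow_add f, mul_apply_eq_comp, hk, map_zero, smul_zero]

theorem hasDerivAt_flow (f : E →L[ℝ] E) (x : E) (t : ℝ) :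
    HasDerivAt (fun t => flow f t x) (f (flow f t x)) t := by
  simpa using! (hasDerivAt_exp_smul_const' f t).clm_apply (hasDerivAt_const t x)

/-- Uniqueness of solutions: `t ↦ exp (-t f) y(t)` is constant. -/
theorem eq_flow_of_hasDerivWithinAt {f : E →L[ℝ] E} {y : ℝ → E} {s : Set ℝ} (hs : Convex ℝ s)
    (h0 : 0 ∈ s) (hy : ∀ t ∈ s, HasDerivWithinAt y (f (y t)) s t) {t : ℝ} (ht : t ∈ s) :
    y t = flow f t (y 0) := by
  have hderiv : ∀ t ∈ s, HasDerivWithinAt (fun t => flow f (-t) (y t)) 0 s t := fun t ht => by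
    have hneg : HasDerivAt (fun t => flow f (-t)) (-(flow f (-t) * f)) t := by
      simpa [flow, Function.comp_def] using!
        (hasDerivAt_exp_smul_const f (-t)).scomp t (hasDerivAt_neg t)
    simpa using hneg.hasDerivWithinAt.clm_apply (hy t ht)
  have hconst := hs.norm_image_sub_le_of_norm_hasDerivWithin_le hderiv (C := 0)
    (fun _ _ => norm_zero.le) h0 ht
  rw [zero_mul, norm_le_zero_iff, sub_eq_zero, neg_zero, flow_zero] at hconst
  rw [← flow_apply_flow_neg f t (y t), hconst, one_apply_eq_self]

variable [CompleteSpace F]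

theorem map_flow {f : E →L[ℝ] E} {g : F →L[ℝ] F} {L : E →L[ℝ] F} (hL : ∀ x, L (f x) = g (L x))
    (t : ℝ) (x : E) : L (flow f t x) = flow g t (L x) := by
  simpa [flow_zero] using eq_flow_of_hasDerivWithinAt (y := fun t => L (flow f t x)) convex_univ
    (mem_univ 0) (fun t _ => by
      simpa only [hL, Function.comp_def] using
        (L.hasFDerivAt.comp_hasDerivAt t (hasDerivAt_flow f x t)).hasDerivWithinAt)
    (mem_univ t)

theorem map_mem_stableSubspace {f : E →L[ℝ] E} {g : F →L[ℝ] F} {L : E →L[ℝ] F}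
    (hL : ∀ x, L (f x) = g (L x)) {x : E} (hx : x ∈ stableSubspace f) : L x ∈ stableSubspace g := by
  simpa only [mem_stableSubspace, Function.comp_def, map_flow hL] using
    (L.continuous.tendsto' 0 0 (map_zero L)).comp hx

theorem comap_stableSubspace {f : E →L[ℝ] E} {g : F →L[ℝ] F} {L : E →L[ℝ] F}
    (hL : ∀ x, L (f x) = g (L x)) (hind : Topology.IsInducing L) :
    (stableSubspace g).comap (L : E →ₗ[ℝ] F) = stableSubspace f := by
  ext x
  simp [mem_stableSubspace, hind.tendsto_nhds_iff, Function.comp_def, map_flow hL]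

theorem stableSubspace_prodMap (f : E →L[ℝ] E) (g : F →L[ℝ] F) :
    stableSubspace (f.prodMap g) = (stableSubspace f).prod (stableSubspace g) := by
  ext x
  have hfst (t : ℝ) : (flow (f.prodMap g) t x).1 = flow f t x.1 :=
    map_flow (L := .fst ℝ E F) (fun _ => rfl) t x
  have hsnd (t : ℝ) : (flow (f.prodMap g) t x).2 = flow g t x.2 :=
    map_flow (L := .snd ℝ E F) (fun _ => rfl) t x
  simp [mem_stableSubspace, Submodule.mem_prod, Prod.tendsto_iff, hfst, hsnd]

section Complex

variable {V : Type*} [NormedAddCommGroup V] [NormedSpace ℂ V] {f : V →L[ℂ] V}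

theorem flow_eq_exp_smul_flow_sub [CompleteSpace V] (f : V →L[ℂ] V) (μ : ℂ) (t : ℝ) (x : V) :
    flow (f.restrictScalars ℝ) t x =
      Complex.exp (t * μ) • flow ((f - μ • 1).restrictScalars ℝ) t x := by
  let g := (f - μ • 1).restrictScalars ℝ
  refine .trans (by simp [flow_zero]) (eq_flow_of_hasDerivWithinAt (f := f.restrictScalars ℝ)
    (y := fun t : ℝ => Complex.exp (t * μ) • flow g t x)
    convex_univ (mem_univ 0) (fun t _ => ?_) (mem_univ t)).symm
  have hexp : HasDerivAt (fun t : ℝ => Complex.exp (t * μ)) (Complex.exp (t * μ) * μ) t := by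
    simpa using ((hasDerivAt_id (t : ℂ)).mul_const μ).cexp.comp_ofReal
  convert! (hexp.smul (hasDerivAt_flow g x t)).hasDerivWithinAt using 1
  simp [g, smul_sub, smul_smul]

theorem tendsto_pow_mul_exp_atTop {μ : ℂ} (hμ : μ.re < 0) (j : ℕ) :
    Tendsto (fun t : ℝ => (t : ℂ) ^ j * Complex.exp (t * μ)) atTop (𝓝 0) := by
  rw [tendsto_zero_iff_norm_tendsto_zero]
  refine (tendsto_rpow_mul_exp_neg_mul_atTop_nhds_zero j (-μ.re) (neg_pos.2 hμ)).congr' ?_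
  filter_upwards [eventually_ge_atTop 0] with t ht
  simp [Complex.norm_exp, abs_of_nonneg ht, mul_comm]

theorem flow_apply_of_apply_eq_smul [CompleteSpace V] {v : V} {μ : ℂ} (hv : f v = μ • v) (t : ℝ) :
    flow (f.restrictScalars ℝ) t v = Complex.exp (t * μ) • v := by
  rw [flow_eq_exp_smul_flow_sub f μ, flow_eq_sum_of_pow_apply_eq_zero (k := 1) (by simp [hv])]
  simp

variable [FiniteDimensional ℂ V]

theorem stableSubspace_eq_top_of_re_neg
    (hf : ∀ μ, End.HasEigenvalue (f : V →ₗ[ℂ] V) μ → μ.re < 0) :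
    stableSubspace (f.restrictScalars ℝ) = ⊤ := by
  have := FiniteDimensional.complete ℂ V
  have htop : ⨆ μ, End.maxGenEigenspace (f : V →ₗ[ℂ] V) μ = ⊤ :=
    End.iSup_maxGenEigenspace_eq_top _
  refine eq_top_iff.2 fun x _ => Submodule.iSup_induction _
    (motive := (· ∈ stableSubspace (f.restrictScalars ℝ))) (htop ▸ Submodule.mem_top (x := x))
    (fun μ x hx => ?_) (Submodule.zero_mem _) fun _ _ => Submodule.add_mem _
  obtain ⟨k, hk⟩ := (End.mem_maxGenEigenspace _ _ _).1 hx
  rcases eq_or_ne x 0 with rfl | hx0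
  · exact Submodule.zero_mem _
  have hμ : μ.re < 0 := hf μ <| End.hasEigenvalue_of_hasGenEigenvalue (k := k) fun hbot =>
    hx0 ((Submodule.mem_bot ℂ).1 (hbot ▸ End.mem_genEigenspace_nat.2 hk))
  let N := (f - μ • 1).restrictScalars ℝ
  have hN : (N ^ k) x = 0 := by
    rw [← hk, FunLike.coe_pow_eq_iterate, End.coe_pow]
    rfl
  have hflow (t : ℝ) : flow (f.restrictScalars ℝ) t x = ∑ j ∈ Finset.range k,
      ((t : ℂ) ^ j * Complex.exp (t * μ)) • (j !⁻¹ : ℝ) • (N ^ j) x := by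
    rw [flow_eq_exp_smul_flow_sub f μ, flow_eq_sum_of_pow_apply_eq_zero hN, Finset.smul_sum]
    refine Finset.sum_congr rfl fun j _ => ?_
    simp only [← Complex.coe_smul, smul_smul]
    congr 1
    push_cast
    ring
  rw [mem_stableSubspace]
  simp only [hflow]
  simpa using tendsto_finsetSum (Finset.range k) fun j _ =>
    (tendsto_pow_mul_exp_atTop hμ j).smul_const ((j !⁻¹ : ℝ) • (N ^ j) x)

theorem stableSubspace_eq_bot_of_re_nonneg
    (hf : ∀ μ, End.HasEigenvalue (f : V →ₗ[ℂ] V) μ → 0 ≤ μ.re) :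
    stableSubspace (f.restrictScalars ℝ) = ⊥ := by
  have := FiniteDimensional.complete ℂ V
  let S : Submodule ℂ V :=
    { stableSubspace (f.restrictScalars ℝ) with
      smul_mem' := fun c _ hx => map_mem_stableSubspace
        (L := (c • ContinuousLinearMap.id ℂ V).restrictScalars ℝ) (by simp) hx }
  have hmaps : ∀ x ∈ S, (f : V →ₗ[ℂ] V) x ∈ S := fun x hx =>
    map_mem_stableSubspace (L := f.restrictScalars ℝ) (fun _ => rfl) hx
  suffices hS : S = ⊥ by
    refine (Submodule.eq_bot_iff _).2 fun x hx => (Submodule.eq_bot_iff _).1 hS x hx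
  by_contra hne
  have : Nontrivial S := Submodule.nontrivial_iff_ne_bot.2 hne
  obtain ⟨μ, hμ⟩ := End.exists_eigenvalue ((f : V →ₗ[ℂ] V).restrict hmaps)
  obtain ⟨v, hv⟩ := hμ.exists_hasEigenvector
  have hv0 : (v : V) ≠ 0 := fun h => hv.2 (Subtype.ext h)
  have hfv : f v = μ • (v : V) := congrArg Subtype.val hv.apply_eq_smul
  have hre : 0 ≤ μ.re := hf μ (End.hasEigenvalue_of_hasEigenvector
    (End.hasEigenvector_iff.2 ⟨End.mem_eigenspace_iff.2 hfv, hv0⟩))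
  have htend : Tendsto (fun t => flow (f.restrictScalars ℝ) t v) atTop (𝓝 0) := v.2
  simp only [flow_apply_of_apply_eq_smul hfv] at htend
  have hle : ∀ᶠ t : ℝ in atTop, ‖(v : V)‖ ≤ ‖Complex.exp (t * μ) • (v : V)‖ := by
    filter_upwards [eventually_ge_atTop 0] with t ht
    rw [norm_smul, Complex.norm_exp]
    exact le_mul_of_one_le_left (norm_nonneg _)
      (Real.one_le_exp (by simpa using mul_nonneg ht hre))
  exact hv0 (norm_le_zero_iff.1 (by simpa using ge_of_tendsto htend.norm hle))

end Complex

end Flow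

/-! ### The unobservable subspace -/

section Unobservable

open Module Polynomial

variable {R M M' N : Type*} [CommRing R] [AddCommGroup M] [Module R M] [AddCommGroup M']
  [Module R M'] [AddCommGroup N] [Module R N]

/-- The unobservable subspace of the linear system with dynamics `f` and observation map `c`:
the common kernel of the maps `c ∘ f ^ k`. -/
def unobservable (f : End R M) (c : M →ₗ[R] N) : Submodule R M :=
  ⨅ k : ℕ, LinearMap.ker (c ∘ₗ f ^ k)

variable {f : End R M} {c : M →ₗ[R] N} {g : End R M'} {d : M' →ₗ[R] N}

theorem mem_unobservable {x : M} : x ∈ unobservable f c ↔ ∀ k : ℕ, c ((f ^ k) x) = 0 := by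
  simp only [unobservable, Submodule.mem_iInf, LinearMap.mem_ker, LinearMap.comp_apply]

theorem obs_aeval_eq_zero {x : M} {q : R[X]} (hx : ∀ k ∈ q.support, c ((f ^ k) x) = 0) :
    c (aeval f q x) = 0 := by
  rw [aeval_eq_sum_range, LinearMap.sum_apply, map_sum]
  refine Finset.sum_eq_zero fun k _ => ?_
  by_cases hk : q.coeff k = 0
  · rw [hk, zero_smul, LinearMap.zero_apply, map_zero]
  · rw [LinearMap.smul_apply, map_smul, hx k (mem_support_iff.2 hk), smul_zero]

theorem aeval_mem_unobservable (q : R[X]) {x : M} (hx : x ∈ unobservable f c) :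
    aeval f q x ∈ unobservable f c := by
  refine mem_unobservable.2 fun k => ?_
  have haeval : (f ^ k) (aeval f q x) = aeval f (X ^ k * q) x := by
    rw [map_mul, map_pow, aeval_X, End.mul_apply]
  rw [haeval]
  exact obs_aeval_eq_zero fun k _ => mem_unobservable.1 hx k

theorem mem_unobservable_iff_of_aeval_eq_zero {p : R[X]} (hp : p.Monic) (hf : aeval f p = 0)
    {x : M} : x ∈ unobservable f c ↔ ∀ k < p.natDegree, c ((f ^ k) x) = 0 := by
  refine ⟨fun hx k _ => mem_unobservable.1 hx k, fun hx => mem_unobservable.2 fun k => ?_⟩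
  rcases subsingleton_or_nontrivial R with hR | hR
  · have := Module.subsingleton R N
    exact Subsingleton.elim _ _
  rw [← aeval_X_pow (R := R) f, ← aeval_modByMonic_eq_self_of_root hf]
  refine obs_aeval_eq_zero fun j hj => hx j ?_
  exact_mod_cast ((le_degree_of_mem_supp j hj).trans_lt (degree_modByMonic_lt _ hp)).trans_le
    degree_le_natDegree

theorem apply_aeval_of_semiconj {L : M →ₗ[R] M'} (hL : ∀ x, L (f x) = g (L x)) (q : R[X])
    (x : M) : L (aeval f q x) = aeval g q (L x) := by
  have hpow (k : ℕ) : L ((f ^ k) x) = (g ^ k) (L x) := by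
    simp only [End.pow_apply]
    exact (Function.Semiconj.iterate_right (f := L) hL k) x
  simp only [aeval_eq_sum_range, LinearMap.sum_apply, LinearMap.smul_apply, map_sum, map_smul, hpow]

theorem comap_unobservable {L : M →ₗ[R] M'} (hL : ∀ x, L (f x) = g (L x))
    (hc : ∀ x, d (L x) = c x) : (unobservable g d).comap L = unobservable f c := by
  have hpow (k : ℕ) (x : M) : L ((f ^ k) x) = (g ^ k) (L x) := by
    simpa only [map_pow, aeval_X] using apply_aeval_of_semiconj hL (X ^ k) x
  ext x
  simp only [Submodule.mem_comap, mem_unobservable, ← hpow, hc]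

theorem aeval_prodMap (f : End R M) (g : End R M') (q : R[X]) :
    aeval (f.prodMap g : End R (M × M')) q = (aeval f q).prodMap (aeval g q) := by
  have := aeval_algHom_apply (LinearMap.prodMapAlgHom R M M') (f, g) q
  rwa [aeval_prod_apply] at this

theorem unobservable_prodMap {p q : R[X]} (hpq : IsCoprime p q) (hf : aeval f p = 0)
    (hg : aeval g q = 0) :
    unobservable (f.prodMap g) (c.coprod d) = (unobservable f c).prod (unobservable g d) := by
  have hinl : (unobservable (f.prodMap g) (c.coprod d)).comap (.inl R M M') = unobservable f c :=
    comap_unobservable (by simp) (by simp)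
  have hinr : (unobservable (f.prodMap g) (c.coprod d)).comap (.inr R M M') = unobservable g d :=
    comap_unobservable (by simp) (by simp)
  ext ⟨x, y⟩
  rw [Submodule.mem_prod, ← hinl, ← hinr, Submodule.mem_comap, Submodule.mem_comap,
    LinearMap.inl_apply, LinearMap.inr_apply]
  constructor
  · intro hxy
    obtain ⟨a, b, hab⟩ := hpq
    -- `b * q` acts as the projection onto the first factor
    have hproj : aeval (f.prodMap g) (b * q) (x, y) = (x, 0) := by
      have hf1 : aeval f (b * q) = 1 := by
        rw [eq_sub_of_add_eq' hab, map_sub, map_mul, hf, mul_zero, map_one, sub_zero]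
      have hg0 : aeval g (b * q) = 0 := by rw [map_mul, hg, mul_zero]
      simp [aeval_prodMap, hf1, hg0]
    have hx := hproj ▸ aeval_mem_unobservable (b * q) hxy
    exact ⟨hx, by simpa using Submodule.sub_mem _ hxy hx⟩
  · rintro ⟨hx, hy⟩
    simpa using Submodule.add_mem _ hx hy

theorem mem_unobservable_iff_flow {E F : Type*} [NormedAddCommGroup E] [NormedSpace ℝ E]
    [CompleteSpace E] [NormedAddCommGroup F] [NormedSpace ℝ F] {f : E →L[ℝ] E} {c : E →L[ℝ] F}
    {x : E} : x ∈ unobservable (f : End ℝ E) (c : E →ₗ[ℝ] F) ↔ ∀ t, c (flow f t x) = 0 := by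
  have hpow (k : ℕ) : ((f : End ℝ E) ^ k) x = (f ^ k) x := by
    rw [End.pow_apply, FunLike.coe_pow_eq_iterate, ContinuousLinearMap.coe_coe]
  simp only [mem_unobservable, hpow, ContinuousLinearMap.coe_coe]
  constructor
  · intro hx t
    have hsum := (hasSum_flow f t x).mapL c
    simp only [map_smul, hx, smul_zero] at hsum
    exact hsum.unique hasSum_zero
  · intro hx k
    suffices hk : ∀ t, c (flow f t ((f ^ k) x)) = 0 by simpa [flow_zero] using hk 0
    induction k with
    | zero => simpa using hx
    | succ k ih =>
      intro t
      have hderiv : HasDerivAt (fun t => c (flow f t ((f ^ k) x)))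
          (c (f (flow f t ((f ^ k) x)))) t :=
        c.hasFDerivAt.comp_hasDerivAt t (hasDerivAt_flow f _ t)
      simp only [ih] at hderiv
      rw [pow_succ', mul_apply_eq_comp, ← map_flow (L := f) (fun _ => rfl)]
      exact hderiv.unique (hasDerivAt_const t 0)

end Unobservable

/-! ### Real matrices -/

namespace ObservedODE

section Matrix

open Matrix Module Polynomial

variable {n p : ℕ}

/-- The continuous linear map `x ↦ A *ᵥ x`. -/
noncomputable def mulVecCLM (A : Matrix (Fin p) (Fin n) ℝ) : (Fin n → ℝ) →L[ℝ] (Fin p → ℝ) :=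
  A.toLin'.toContinuousLinearMap

theorem mulVecCLM_neg (A : Matrix (Fin p) (Fin n) ℝ) : mulVecCLM (-A) = -mulVecCLM A := by
  ext1 x
  exact neg_mulVec x A

theorem exists_complexification (A : Matrix (Fin n) (Fin n) ℝ) :
    ∃ (g : (Fin n → ℂ) →L[ℂ] (Fin n → ℂ)) (L : (Fin n → ℝ) →L[ℝ] (Fin n → ℂ)),
      Topology.IsClosedEmbedding L ∧ (∀ x, L (mulVecCLM A x) = g (L x)) ∧
        ∀ μ, End.HasEigenvalue (g : (Fin n → ℂ) →ₗ[ℂ] (Fin n → ℂ)) μ ↔ μ ∈ eigenvalues A := by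
  let g : (Fin n → ℂ) →L[ℂ] (Fin n → ℂ) :=
    (A.map (algebraMap ℝ ℂ)).toLin'.toContinuousLinearMap
  let L : (Fin n → ℝ) →L[ℝ] (Fin n → ℂ) :=
    .pi fun i => Complex.ofRealCLM.comp (.proj i)
  have hL : Function.Injective L := fun x y hxy =>
    funext fun i => Complex.ofReal_injective (congrFun hxy i)
  refine ⟨g, L, LinearMap.isClosedEmbedding_of_injective (LinearMap.ker_eq_bot.2 hL),
    fun x => ?_, fun μ => ?_⟩
  · exact funext (RingHom.map_mulVec (algebraMap ℝ ℂ) A x)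
  · rw [End.hasEigenvalue_iff_mem_spectrum, eigenvalues, ← Matrix.spectrum_toLin']
    rfl

theorem stableSubspace_mulVecCLM_eq_top {A : Matrix (Fin n) (Fin n) ℝ}
    (hA : ∀ μ ∈ eigenvalues A, μ.re < 0) : stableSubspace (mulVecCLM A) = ⊤ := by
  obtain ⟨g, L, hemb, hL, hg⟩ := exists_complexification A
  rw [← comap_stableSubspace (g := g.restrictScalars ℝ) hL hemb.isInducing,
    stableSubspace_eq_top_of_re_neg fun μ hμ => hA μ ((hg μ).1 hμ), Submodule.comap_top]

theorem stableSubspace_mulVecCLM_eq_bot {A : Matrix (Fin n) (Fin n) ℝ}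
    (hA : ∀ μ ∈ eigenvalues A, 0 ≤ μ.re) : stableSubspace (mulVecCLM A) = ⊥ := by
  obtain ⟨g, L, hemb, hL, hg⟩ := exists_complexification A
  rw [← comap_stableSubspace (g := g.restrictScalars ℝ) hL hemb.isInducing,
    stableSubspace_eq_bot_of_re_nonneg fun μ hμ => hA μ ((hg μ).1 hμ),
    Submodule.comap_bot, LinearMap.ker_eq_bot]
  exact hemb.injective

theorem neg_mem_eigenvalues {A : Matrix (Fin n) (Fin n) ℝ} {μ : ℂ}
    (hμ : μ ∈ eigenvalues (-A)) : -μ ∈ eigenvalues A := by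
  have hmap : (-A).map (algebraMap ℝ ℂ) = -A.map (algebraMap ℝ ℂ) := by ext; simp
  rwa [eigenvalues, hmap, ← spectrum.neg_eq, Set.mem_neg] at hμ

theorem isCoprime_of_aeval_ne_zero {q r : ℝ[X]} (h : ∀ z : ℂ, aeval z q = 0 → aeval z r ≠ 0) :
    IsCoprime q r :=
  (isCoprime_iff_aeval_ne_zero_of_isAlgClosed ℝ ℂ q r).2 fun z =>
    or_iff_not_imp_left.2 fun hz => h z (not_not.1 hz)

theorem mem_eigenvalues_iff_aeval_charpoly_eq_zero {A : Matrix (Fin n) (Fin n) ℝ} {μ : ℂ} :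
    μ ∈ eigenvalues A ↔ aeval μ A.charpoly = 0 := by
  rw [eigenvalues, Matrix.mem_spectrum_iff_isRoot_charpoly, Matrix.charpoly_map, IsRoot.def,
    eval_map_algebraMap]

theorem aeval_toLin'_charpoly (A : Matrix (Fin n) (Fin n) ℝ) : aeval A.toLin' A.charpoly = 0 := by
  rw [← A.charpoly_toLin', LinearMap.aeval_self_charpoly]

theorem ker_obsMatrix_eq_unobservable (A : Matrix (Fin n) (Fin n) ℝ)
    (C : Matrix (Fin p) (Fin n) ℝ) :
    LinearMap.ker (obsMatrix A C).mulVecLin = unobservable A.toLin' C.toLin' := by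
  ext x
  have hrow (i : Fin n) (j : Fin p) :
      (obsMatrix A C *ᵥ x) (i, j) = C.toLin' ((A.toLin' ^ (i : ℕ)) x) j := by
    rw [← toLin'_pow, toLin'_apply, toLin'_apply, mulVec_mulVec]
    rfl
  rw [mem_unobservable_iff_of_aeval_eq_zero A.charpoly_monic (aeval_toLin'_charpoly A),
    charpoly_natDegree_eq_dim, Fintype.card_fin]
  simp only [LinearMap.mem_ker, mulVecLin_apply, funext_iff, Prod.forall, hrow, Fin.forall_iff]
  rfl

theorem kObs_add_finrank_unobservable (A : Matrix (Fin n) (Fin n) ℝ)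
    (C : Matrix (Fin p) (Fin n) ℝ) :
    kObs A C + finrank ℝ (unobservable A.toLin' C.toLin') = n := by
  rw [← ker_obsMatrix_eq_unobservable, kObs, Matrix.rank,
    LinearMap.finrank_range_add_finrank_ker, finrank_fin_fun]

end Matrix

end ObservedODE

/-! ### Spectral forms -/

namespace ObservedODE

section SpectralForm

open Matrix Module Polynomial

variable {n p a b c : ℕ}

theorem finrank_submodule_prod {K V W : Type*} [DivisionRing K] [AddCommGroup V] [Module K V]
    [AddCommGroup W] [Module K W] (S : Submodule K V) (T : Submodule K W) [FiniteDimensional K S]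
    [FiniteDimensional K T] : finrank K (S.prod T) = finrank K S + finrank K T := by
  have hinj : Function.Injective (S.subtype.prodMap T.subtype) :=
    S.injective_subtype.prodMap T.injective_subtype
  rw [← finrank_prod, ← LinearMap.finrank_range_of_inj hinj, LinearMap.range_prodMap,
    S.range_subtype, T.range_subtype]

theorem isCoprime_charpoly {A : Matrix (Fin a) (Fin a) ℝ} {B : Matrix (Fin b) (Fin b) ℝ}
    (h : ∀ μ ∈ eigenvalues A, μ ∉ eigenvalues B) : IsCoprime A.charpoly B.charpoly :=
  isCoprime_of_aeval_ne_zero <| by simpa only [mem_eigenvalues_iff_aeval_charpoly_eq_zero] using h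

/-- The identification of vectors with three blocks of coordinates and triples of vectors. -/
def blockEquiv (a b c : ℕ) :
    (Fin a ⊕ (Fin b ⊕ Fin c) → ℝ) ≃ₗ[ℝ] (Fin a → ℝ) × (Fin b → ℝ) × (Fin c → ℝ) :=
  LinearEquiv.sumArrowLequivProdArrow (Fin a) (Fin b ⊕ Fin c) ℝ ℝ ≪≫ₗ
    (LinearEquiv.refl ℝ _).prodCongr (LinearEquiv.sumArrowLequivProdArrow (Fin b) (Fin c) ℝ ℝ)

theorem blockEquiv_fromBlocks_mulVec (A : Matrix (Fin a) (Fin a) ℝ) (B : Matrix (Fin b) (Fin b) ℝ)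
    (C : Matrix (Fin c) (Fin c) ℝ) (x : Fin a ⊕ (Fin b ⊕ Fin c) → ℝ) :
    blockEquiv a b c (fromBlocks A 0 0 (fromBlocks B 0 0 C) *ᵥ x) =
      A.toLin'.prodMap (B.toLin'.prodMap C.toLin') (blockEquiv a b c x) := by
  simp only [fromBlocks_mulVec, zero_mulVec, add_zero, zero_add]
  rfl

theorem fromCols_mulVec_eq_coprod (A : Matrix (Fin p) (Fin a) ℝ) (B : Matrix (Fin p) (Fin b) ℝ)
    (C : Matrix (Fin p) (Fin c) ℝ) (x : Fin a ⊕ (Fin b ⊕ Fin c) → ℝ) :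
    fromCols A (fromCols B C) *ᵥ x =
      A.toLin'.coprod (B.toLin'.coprod C.toLin') (blockEquiv a b c x) := by
  simp only [fromCols_mulVec]
  rfl

namespace SpectralForm

variable {A : Matrix (Fin n) (Fin n) ℝ} {C : Matrix (Fin p) (Fin n) ℝ} (D : SpectralForm A C)

/-- The linear change of coordinates given by the matrices of a spectral form. -/
noncomputable def equiv :
    (Fin n → ℝ) ≃ₗ[ℝ] (Fin D.nZero → ℝ) × (Fin D.nPlus → ℝ) × (Fin D.nMinus → ℝ) :=
  toLin'OfInv D.mul_inv D.inv_mul ≪≫ₗ blockEquiv D.nZero D.nPlus D.nMinus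

theorem equiv_apply (x : Fin n → ℝ) : D.equiv x = blockEquiv _ _ _ (D.Q *ᵥ x) :=
  rfl

theorem equiv_mulVec (x : Fin n → ℝ) :
    D.equiv (A *ᵥ x) =
      D.AZero.toLin'.prodMap (D.APlus.toLin'.prodMap D.AMinus.toLin') (D.equiv x) := by
  rw [equiv_apply, equiv_apply, ← blockEquiv_fromBlocks_mulVec, ← D.conj_eq, mulVec_mulVec,
    mulVec_mulVec, Matrix.mul_assoc, D.mul_inv, Matrix.mul_one]

theorem coprod_equiv (x : Fin n → ℝ) :
    D.CZero.toLin'.coprod (D.CPlus.toLin'.coprod D.CMinus.toLin') (D.equiv x) = C *ᵥ x := by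
  rw [equiv_apply, ← fromCols_mulVec_eq_coprod, ← D.obs_eq, mulVec_mulVec, Matrix.mul_assoc,
    D.mul_inv, Matrix.mul_one]

theorem finrank_comap_equiv (U : Submodule ℝ (Fin D.nZero → ℝ))
    (V : Submodule ℝ (Fin D.nPlus → ℝ)) (W : Submodule ℝ (Fin D.nMinus → ℝ)) :
    finrank ℝ ((U.prod (V.prod W)).comap D.equiv.toLinearMap) =
      finrank ℝ U + (finrank ℝ V + finrank ℝ W) := by
  rw [Submodule.comap_equiv_eq_map_symm, LinearEquiv.finrank_map_eq,
    finrank_submodule_prod, finrank_submodule_prod]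

theorem stableSubspace_eq_comap :
    stableSubspace (mulVecCLM A) =
      (Submodule.prod ⊥ (Submodule.prod ⊥ ⊤)).comap D.equiv.toLinearMap := by
  rw [← comap_stableSubspace (L := (D.equiv.toContinuousLinearEquiv : (Fin n → ℝ) →L[ℝ] _))
      (g := (mulVecCLM D.AZero).prodMap ((mulVecCLM D.APlus).prodMap (mulVecCLM D.AMinus)))
      D.equiv_mulVec D.equiv.toContinuousLinearEquiv.toHomeomorph.isInducing,
    stableSubspace_prodMap, stableSubspace_prodMap,
    stableSubspace_mulVecCLM_eq_bot fun μ hμ => (D.re_zero μ hμ).ge,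
    stableSubspace_mulVecCLM_eq_bot fun μ hμ => (D.re_pos μ hμ).le,
    stableSubspace_mulVecCLM_eq_top D.re_neg]
  rfl

theorem stableSubspace_neg_eq_comap :
    stableSubspace (-mulVecCLM A) =
      (Submodule.prod ⊥ (Submodule.prod ⊤ ⊥)).comap D.equiv.toLinearMap := by
  rw [← comap_stableSubspace (L := (D.equiv.toContinuousLinearEquiv : (Fin n → ℝ) →L[ℝ] _))
      (g := (mulVecCLM (-D.AZero)).prodMap
        ((mulVecCLM (-D.APlus)).prodMap (mulVecCLM (-D.AMinus)))) ?_
      D.equiv.toContinuousLinearEquiv.toHomeomorph.isInducing,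
    stableSubspace_prodMap, stableSubspace_prodMap,
    stableSubspace_mulVecCLM_eq_bot fun μ hμ => by
      simpa using (D.re_zero _ (neg_mem_eigenvalues hμ)).le,
    stableSubspace_mulVecCLM_eq_top fun μ hμ => by
      simpa using D.re_pos _ (neg_mem_eigenvalues hμ),
    stableSubspace_mulVecCLM_eq_bot fun μ hμ => by
      simpa using (D.re_neg _ (neg_mem_eigenvalues hμ)).le]
  · rfl
  · intro x
    simp only [mulVecCLM_neg]
    exact (map_neg D.equiv _).trans (congrArg Neg.neg (D.equiv_mulVec x))

theorem unobservable_eq_comap :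
    unobservable A.toLin' C.toLin' =
      ((unobservable D.AZero.toLin' D.CZero.toLin').prod
        ((unobservable D.APlus.toLin' D.CPlus.toLin').prod
          (unobservable D.AMinus.toLin' D.CMinus.toLin'))).comap
        D.equiv.toLinearMap := by
  have h₁₂ : IsCoprime D.APlus.charpoly D.AMinus.charpoly :=
    isCoprime_charpoly fun μ hp hm => (D.re_neg μ hm).not_gt (D.re_pos μ hp)
  have h₀ : IsCoprime D.AZero.charpoly (D.APlus.charpoly * D.AMinus.charpoly) :=
    .mul_right (isCoprime_charpoly fun μ hz hp => (D.re_pos μ hp).ne' (D.re_zero μ hz))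
      (isCoprime_charpoly fun μ hz hm => (D.re_neg μ hm).ne (D.re_zero μ hz))
  have hann : aeval (D.APlus.toLin'.prodMap D.AMinus.toLin')
      (D.APlus.charpoly * D.AMinus.charpoly) = 0 := by
    rw [aeval_prodMap, map_mul, map_mul, aeval_toLin'_charpoly, aeval_toLin'_charpoly, zero_mul,
      mul_zero, LinearMap.prodMap_zero]
  rw [← comap_unobservable D.equiv_mulVec D.coprod_equiv,
    unobservable_prodMap h₀ (aeval_toLin'_charpoly _) hann,
    unobservable_prodMap h₁₂ (aeval_toLin'_charpoly _) (aeval_toLin'_charpoly _)]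

theorem nZero_add_nPlus_add_nMinus : D.nZero + (D.nPlus + D.nMinus) = n := by
  simpa using D.equiv.finrank_eq.symm

theorem kObsMinus_add_finrank_unobservable_inf_stableSubspace :
    D.kObsMinus + finrank ℝ ↥(unobservable A.toLin' C.toLin' ⊓ stableSubspace (mulVecCLM A)) =
      D.nMinus := by
  rw [unobservable_eq_comap, stableSubspace_eq_comap, ← Submodule.comap_inf,
    Submodule.prod_inf_prod, Submodule.prod_inf_prod, finrank_comap_equiv, inf_bot_eq, inf_bot_eq,
    inf_top_eq, finrank_bot, finrank_bot, zero_add, zero_add]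
  exact kObs_add_finrank_unobservable D.AMinus D.CMinus

theorem kObsPlus_add_finrank_unobservable_inf_stableSubspace_neg :
    D.kObsPlus + finrank ℝ ↥(unobservable A.toLin' C.toLin' ⊓ stableSubspace (-mulVecCLM A)) =
      D.nPlus := by
  rw [unobservable_eq_comap, stableSubspace_neg_eq_comap, ← Submodule.comap_inf,
    Submodule.prod_inf_prod, Submodule.prod_inf_prod, finrank_comap_equiv, inf_bot_eq, inf_bot_eq,
    inf_top_eq, finrank_bot, finrank_bot, zero_add, add_zero]
  exact kObs_add_finrank_unobservable D.APlus D.CPlus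

theorem finrank_stableSubspace : finrank ℝ (stableSubspace (mulVecCLM A)) = D.nMinus := by
  rw [D.stableSubspace_eq_comap, finrank_comap_equiv]
  simp

theorem finrank_stableSubspace_neg : finrank ℝ (stableSubspace (-mulVecCLM A)) = D.nPlus := by
  rw [D.stableSubspace_neg_eq_comap, finrank_comap_equiv]
  simp

theorem kObs_eq : kObs A C = D.kObsZero + (D.kObsPlus + D.kObsMinus) := by
  have h := kObs_add_finrank_unobservable A C
  rw [D.unobservable_eq_comap, finrank_comap_equiv] at h
  have h₀ := kObs_add_finrank_unobservable D.AZero D.CZero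
  have h₁ := kObs_add_finrank_unobservable D.APlus D.CPlus
  have h₂ := kObs_add_finrank_unobservable D.AMinus D.CMinus
  have hn := D.nZero_add_nPlus_add_nMinus
  simp only [kObsZero, kObsPlus, kObsMinus]
  lia

end SpectralForm

end SpectralForm

end ObservedODE

/-! ### Existence of spectral forms -/

section Splitting

open Module Polynomial

variable {K V : Type*} [Field K] [AddCommGroup V] [Module K V] [FiniteDimensional K V]

theorem exists_equiv_ker_aeval (f : End K V) (q : K[X]) :
    ∃ (k : ℕ) (g : End K (Fin k → K)) (e : LinearMap.ker (aeval f q) ≃ₗ[K] (Fin k → K)),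
      aeval g q = 0 ∧ ∀ y, f (e.symm y) = e.symm (g y) := by
  have hinv : ∀ x ∈ LinearMap.ker (aeval f q), f x ∈ LinearMap.ker (aeval f q) := fun x hx => by
    rw [LinearMap.mem_ker] at hx ⊢
    rw [← apply_aeval_of_semiconj (L := f) (fun _ => rfl), hx, map_zero]
  let e := (finBasis K (LinearMap.ker (aeval f q))).equivFun
  refine ⟨_, e.conj (f.restrict hinv), e, ?_, fun y => ?_⟩
  · have hsemi (y) : (Submodule.subtype _ ∘ₗ e.symm.toLinearMap) (e.conj (f.restrict hinv) y) =
        f ((Submodule.subtype _ ∘ₗ e.symm.toLinearMap) y) := by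
      simp [LinearEquiv.conj_apply]
    refine LinearMap.ext fun y => ?_
    refine (Submodule.injective_subtype _).comp e.symm.injective ?_
    simpa using (apply_aeval_of_semiconj hsemi q y).trans (LinearMap.mem_ker.1 (e.symm y).2)
  · simp [LinearEquiv.conj_apply]

theorem exists_equiv_prodMap_of_isCoprime {f : End K V} {p q : K[X]} (hpq : IsCoprime p q)
    (hf : aeval f (p * q) = 0) :
    ∃ (a b : ℕ) (g : End K (Fin a → K)) (h : End K (Fin b → K))
      (e : V ≃ₗ[K] (Fin a → K) × (Fin b → K)),
      aeval g p = 0 ∧ aeval h q = 0 ∧ ∀ x, e (f x) = g.prodMap h (e x) := by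
  obtain ⟨a, g, e, hg, he⟩ := exists_equiv_ker_aeval f p
  obtain ⟨b, h, e', hh, he'⟩ := exists_equiv_ker_aeval f q
  have hcompl : IsCompl (LinearMap.ker (aeval f p)) (LinearMap.ker (aeval f q)) :=
    ⟨disjoint_ker_aeval_of_isCoprime f hpq, codisjoint_iff.2 <| by
      rw [sup_ker_aeval_eq_ker_aeval_mul_of_coprime f hpq, hf, LinearMap.ker_zero]⟩
  let E := (e.symm.prodCongr e'.symm) ≪≫ₗ Submodule.prodEquivOfIsCompl _ _ hcompl
  have hE (y) : f (E y) = E (g.prodMap h y) := by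
    simp [E, he, he']
  refine ⟨a, b, g, h, E.symm, hg, hh, fun x => ?_⟩
  rw [LinearEquiv.symm_apply_eq, ← hE, LinearEquiv.apply_symm_apply]

end Splitting

section RealPolynomial

open Polynomial

theorem re_eq_of_irreducible {q : ℝ[X]} (hq : Irreducible q) {z w : ℂ} (hz : aeval z q = 0)
    (hw : aeval w q = 0) : z.re = w.re := by
  have hconj : IsConjRoot ℝ z w :=
    (minpoly.eq_of_irreducible hq hz).symm.trans (minpoly.eq_of_irreducible hq hw)
  have : Normal ℝ ℂ := normal_iff.2 fun x =>
    ⟨Algebra.IsIntegral.isIntegral x, IsAlgClosed.splits _⟩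
  obtain ⟨σ, rfl⟩ := isConjRoot_iff_exists_algEquiv.1 hconj
  rcases Complex.real_algHom_eq_id_or_conj (σ : ℂ →ₐ[ℝ] ℂ) with h | h
  · exact congrArg Complex.re (DFunLike.congr_fun h w)
  · exact (congrArg Complex.re (DFunLike.congr_fun h w)).trans (Complex.conj_re w)

theorem exists_mul_eq_re_mem_re_notMem (s : Set ℝ) {q : ℝ[X]} (hq : q ≠ 0) :
    ∃ q₁ q₂ : ℝ[X], q₁ * q₂ = q ∧ (∀ z : ℂ, aeval z q₁ = 0 → z.re ∈ s) ∧
      ∀ z : ℂ, aeval z q₂ = 0 → z.re ∉ s := by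
  induction q using WfDvdMonoid.induction_on_irreducible with
  | zero => exact absurd rfl hq
  | unit u hu =>
    exact ⟨u, 1, mul_one u, fun z hz => absurd hz (hu.map (aeval z)).ne_zero, by simp⟩
  | mul a i ha hi ih =>
    obtain ⟨q₁, q₂, rfl, h₁, h₂⟩ := ih ha
    obtain ⟨w, hw⟩ : ∃ w : ℂ, aeval w i = 0 :=
      IsAlgClosed.exists_aeval_eq_zero ℂ i (degree_pos_of_irreducible hi).ne'
    by_cases hws : w.re ∈ s
    · refine ⟨i * q₁, q₂, mul_assoc .., fun z hz => ?_, h₂⟩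
      rw [map_mul, mul_eq_zero] at hz
      exact hz.elim (fun h => re_eq_of_irreducible hi h hw ▸ hws) (h₁ z)
    · refine ⟨q₁, i * q₂, mul_left_comm .., h₁, fun z hz => ?_⟩
      rw [map_mul, mul_eq_zero] at hz
      exact hz.elim (fun h => re_eq_of_irreducible hi h hw ▸ hws) (h₂ z)

end RealPolynomial

namespace ObservedODE

section Existence

open Matrix Module Polynomial

variable {n p a b c : ℕ}

theorem aeval_eq_zero_of_mem_eigenvalues {f : End ℝ (Fin n → ℝ)} {q : ℝ[X]} (hq : aeval f q = 0)
    {μ : ℂ} (hμ : μ ∈ eigenvalues (LinearMap.toMatrix' f)) : aeval μ q = 0 := by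
  rcases subsingleton_or_nontrivial (Matrix (Fin n) (Fin n) ℂ) with hs | hs
  · rw [eigenvalues, spectrum.of_subsingleton] at hμ
    exact hμ.elim
  let φ : End ℝ (Fin n → ℝ) →ₐ[ℝ] Matrix (Fin n) (Fin n) ℂ :=
    ((Algebra.ofId ℝ ℂ).mapMatrix (m := Fin n)).comp LinearMap.toMatrixAlgEquiv'.toAlgHom
  have hφ : aeval (φ f) (q.map (algebraMap ℝ ℂ)) = 0 := by
    rw [aeval_map_algebraMap, aeval_algHom_apply, hq, map_zero]
  have hmem := spectrum.subset_polynomial_aeval (φ f) (q.map (algebraMap ℝ ℂ)) ⟨μ, hμ, rfl⟩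
  rw [hφ, spectrum.zero_eq, Set.mem_singleton_iff] at hmem
  simpa only [eval_map_algebraMap] using hmem

theorem SpectralForm.nonempty_of_equiv {A : Matrix (Fin n) (Fin n) ℝ}
    (C : Matrix (Fin p) (Fin n) ℝ) {f : End ℝ (Fin a → ℝ)} {g : End ℝ (Fin b → ℝ)}
    {h : End ℝ (Fin c → ℝ)} (e : (Fin n → ℝ) ≃ₗ[ℝ] (Fin a → ℝ) × (Fin b → ℝ) × (Fin c → ℝ))
    (he : ∀ x, e (A *ᵥ x) = f.prodMap (g.prodMap h) (e x))
    (hf : ∀ μ ∈ eigenvalues (LinearMap.toMatrix' f), μ.re = 0)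
    (hg : ∀ μ ∈ eigenvalues (LinearMap.toMatrix' g), 0 < μ.re)
    (hh : ∀ μ ∈ eigenvalues (LinearMap.toMatrix' h), μ.re < 0) :
    Nonempty (SpectralForm A C) := by
  let P := LinearMap.toMatrix' (e.symm.toLinearMap ∘ₗ (blockEquiv a b c).toLinearMap)
  let Q := LinearMap.toMatrix' ((blockEquiv a b c).symm.toLinearMap ∘ₗ e.toLinearMap)
  have hP (x) : P *ᵥ x = e.symm (blockEquiv a b c x) := LinearMap.toMatrix'_mulVec _ x
  have hQ (x) : Q *ᵥ x = (blockEquiv a b c).symm (e x) := LinearMap.toMatrix'_mulVec _ x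
  refine ⟨{
    nZero := a, nPlus := b, nMinus := c
    AZero := LinearMap.toMatrix' f, APlus := LinearMap.toMatrix' g, AMinus := LinearMap.toMatrix' h
    CZero := (C * P).toCols₁, CPlus := (C * P).toCols₂.toCols₁, CMinus := (C * P).toCols₂.toCols₂
    P := P, Q := Q
    mul_inv := ext_iff_mulVec.2 fun x => by simp [← mulVec_mulVec, hP, hQ]
    inv_mul := ext_iff_mulVec.2 fun x => by simp [← mulVec_mulVec, hP, hQ]
    conj_eq := ext_iff_mulVec.2 fun x => (blockEquiv a b c).injective <| by
      simp [← mulVec_mulVec, hP, hQ, he, blockEquiv_fromBlocks_mulVec]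
    obs_eq := by rw [fromCols_toCols, fromCols_toCols]
    re_zero := hf, re_pos := hg, re_neg := hh }⟩

theorem nonempty_spectralForm (A : Matrix (Fin n) (Fin n) ℝ) (C : Matrix (Fin p) (Fin n) ℝ) :
    Nonempty (SpectralForm A C) := by
  obtain ⟨q₀, q₁₂, hq, h₀, h₁₂⟩ := exists_mul_eq_re_mem_re_notMem {0} A.charpoly_monic.ne_zero
  have hq₁₂ : q₁₂ ≠ 0 := right_ne_zero_of_mul (hq ▸ A.charpoly_monic.ne_zero)
  obtain ⟨q₁, q₂, rfl, h₁, h₂⟩ := exists_mul_eq_re_mem_re_notMem (Set.Ioi 0) hq₁₂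
  have hcop₀ : IsCoprime q₀ (q₁ * q₂) :=
    isCoprime_of_aeval_ne_zero fun z hz hz' => h₁₂ z hz' (h₀ z hz)
  have hcop₁₂ : IsCoprime q₁ q₂ :=
    isCoprime_of_aeval_ne_zero fun z hz hz' => h₂ z hz' (h₁ z hz)
  obtain ⟨a, d, f, k, e, hf, hk, he⟩ := exists_equiv_prodMap_of_isCoprime hcop₀
    (hq ▸ aeval_toLin'_charpoly A)
  obtain ⟨b, c, g, h, e', hg, hh, he'⟩ := exists_equiv_prodMap_of_isCoprime hcop₁₂ hk
  refine SpectralForm.nonempty_of_equiv (f := f) (g := g) (h := h) C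
    (e ≪≫ₗ (LinearEquiv.refl ℝ _).prodCongr e') (fun x => ?_)
    (fun μ hμ => h₀ μ (aeval_eq_zero_of_mem_eigenvalues hf hμ))
    (fun μ hμ => h₁ μ (aeval_eq_zero_of_mem_eigenvalues hg hμ)) (fun μ hμ => ?_)
  · simp [← toLin'_apply, he, he']
  · have hz := aeval_eq_zero_of_mem_eigenvalues hh hμ
    exact lt_of_le_of_ne (not_lt.1 (h₂ μ hz)) (h₁₂ μ (by rw [map_mul, hz, mul_zero]))

end Existence

end ObservedODE

/-! ### Invariants of topological equivalence -/

namespace ObservedODE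

section Equivalence

open Matrix Set

variable {n p : ℕ} {A₁ A₂ : Matrix (Fin n) (Fin n) ℝ} {C₁ C₂ : Matrix (Fin p) (Fin n) ℝ}

theorem isTrajectory_flow (A : Matrix (Fin n) (Fin n) ℝ) (C : Matrix (Fin p) (Fin n) ℝ)
    (x : Fin n → ℝ) :
    IsTrajectory A C (fun t => flow (mulVecCLM A) t x) fun t => C *ᵥ flow (mulVecCLM A) t x :=
  ⟨fun t _ => (hasDerivAt_flow (mulVecCLM A) x t).hasDerivWithinAt, fun _ _ => rfl⟩

theorem Brings.apply_flow_of_nonneg {H : (Fin n → ℝ) → (Fin n → ℝ)} (hH : Brings H A₁ C₁ A₂ C₂)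
    {t : ℝ} (ht : 0 ≤ t) (x : Fin n → ℝ) :
    H (flow (mulVecCLM A₁) t x) = flow (mulVecCLM A₂) t (H x) := by
  have := eq_flow_of_hasDerivWithinAt (f := mulVecCLM A₂) (convex_Ici 0) self_mem_Ici
    (hH _ _ (isTrajectory_flow A₁ C₁ x)).1 ht
  simpa only [flow_zero, one_apply_eq_self] using this

theorem Brings.apply_flow {H : (Fin n → ℝ) → (Fin n → ℝ)} (hH : Brings H A₁ C₁ A₂ C₂)
    (t : ℝ) (x : Fin n → ℝ) : H (flow (mulVecCLM A₁) t x) = flow (mulVecCLM A₂) t (H x) := by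
  rcases le_total 0 t with ht | ht
  · exact hH.apply_flow_of_nonneg ht x
  · have hback := hH.apply_flow_of_nonneg (neg_nonneg.2 ht) (flow (mulVecCLM A₁) t x)
    rw [flow_neg_apply_flow] at hback
    rw [hback, flow_apply_flow_neg]

theorem Brings.mulVec_apply {H : (Fin n → ℝ) → (Fin n → ℝ)} (hH : Brings H A₁ C₁ A₂ C₂)
    (x : Fin n → ℝ) : C₂ *ᵥ H x = C₁ *ᵥ x := by
  have := (hH _ _ (isTrajectory_flow A₁ C₁ x)).2 0 self_mem_Ici
  simpa only [flow_zero, one_apply_eq_self] using this.symm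

/-- Subtracting the equilibrium `H 0`, which the second observation does not see, normalizes an
equivalence `H` to fix the origin. -/
theorem TopologicallyEquivalent.exists_homeomorph_flow (h : TopologicallyEquivalent A₁ C₁ A₂ C₂) :
    ∃ H : (Fin n → ℝ) ≃ₜ (Fin n → ℝ), H 0 = 0 ∧
      (∀ t x, H (flow (mulVecCLM A₁) t x) = flow (mulVecCLM A₂) t (H x)) ∧
      ∀ x, C₂ *ᵥ H x = C₁ *ᵥ x := by
  obtain ⟨H, hH, -⟩ := h
  have hfix (t : ℝ) : flow (mulVecCLM A₂) t (H 0) = H 0 := by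
    rw [← hH.apply_flow, map_zero]
  refine ⟨H.trans (Homeomorph.addRight (-H 0)), add_neg_cancel _, fun t x => ?_, fun x => ?_⟩
  · simp only [Homeomorph.trans_apply, Homeomorph.coe_addRight, map_add, map_neg, hfix,
      hH.apply_flow]
  · simp only [Homeomorph.trans_apply, Homeomorph.coe_addRight, mulVec_add, mulVec_neg,
      hH.mulVec_apply, mulVec_zero, neg_zero, add_zero]

theorem TopologicallyEquivalent.exists_homeomorph_mem_iff
    (h : TopologicallyEquivalent A₁ C₁ A₂ C₂) :
    ∃ H : (Fin n → ℝ) ≃ₜ (Fin n → ℝ),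
      (∀ x, x ∈ stableSubspace (mulVecCLM A₁) ↔ H x ∈ stableSubspace (mulVecCLM A₂)) ∧
      (∀ x, x ∈ stableSubspace (-mulVecCLM A₁) ↔ H x ∈ stableSubspace (-mulVecCLM A₂)) ∧
      ∀ x, x ∈ unobservable A₁.toLin' C₁.toLin' ↔ H x ∈ unobservable A₂.toLin' C₂.toLin' := by
  obtain ⟨H, h0, hflow, hobs⟩ := h.exists_homeomorph_flow
  refine ⟨H, fun x => mem_stableSubspace_iff_of_homeomorph h0 hflow,
    fun x => mem_stableSubspace_iff_of_homeomorph h0 fun t x => ?_, fun x => ?_⟩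
  · simp only [flow_neg, hflow]
  · have hmem (A : Matrix (Fin n) (Fin n) ℝ) (C : Matrix (Fin p) (Fin n) ℝ) (x : Fin n → ℝ) :
        x ∈ unobservable A.toLin' C.toLin' ↔ ∀ t, C *ᵥ flow (mulVecCLM A) t x = 0 :=
      mem_unobservable_iff_flow (f := mulVecCLM A) (c := mulVecCLM C)
    simp only [hmem, ← hflow, hobs]

theorem TopologicallyEquivalent.kObs_eq (h : TopologicallyEquivalent A₁ C₁ A₂ C₂) :
    kObs A₁ C₁ = kObs A₂ C₂ := by
  obtain ⟨H, -, -, hobs⟩ := h.exists_homeomorph_mem_iff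
  have h₁ := kObs_add_finrank_unobservable A₁ C₁
  have h₂ := kObs_add_finrank_unobservable A₂ C₂
  rw [finrank_eq_of_homeomorph_mem_iff H hobs] at h₁
  lia

theorem TopologicallyEquivalent.spectralForm_eq (h : TopologicallyEquivalent A₁ C₁ A₂ C₂)
    (D₁ : SpectralForm A₁ C₁) (D₂ : SpectralForm A₂ C₂) :
    D₁.nZero = D₂.nZero ∧ D₁.nPlus = D₂.nPlus ∧ D₁.nMinus = D₂.nMinus ∧
      D₁.kObsZero = D₂.kObsZero ∧ D₁.kObsPlus = D₂.kObsPlus ∧ D₁.kObsMinus = D₂.kObsMinus := by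
  obtain ⟨H, hstable, hunstable, hobs⟩ := h.exists_homeomorph_mem_iff
  have hMinus : D₁.nMinus = D₂.nMinus := by
    rw [← D₁.finrank_stableSubspace, ← D₂.finrank_stableSubspace,
      finrank_eq_of_homeomorph_mem_iff H hstable]
  have hPlus : D₁.nPlus = D₂.nPlus := by
    rw [← D₁.finrank_stableSubspace_neg, ← D₂.finrank_stableSubspace_neg,
      finrank_eq_of_homeomorph_mem_iff H hunstable]
  have hkMinus : D₁.kObsMinus = D₂.kObsMinus := by
    have h₁ := D₁.kObsMinus_add_finrank_unobservable_inf_stableSubspace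
    rw [finrank_eq_of_homeomorph_mem_iff (V := _ ⊓ _) H fun x => and_congr (hobs x) (hstable x),
      hMinus, ← D₂.kObsMinus_add_finrank_unobservable_inf_stableSubspace] at h₁
    exact Nat.add_right_cancel h₁
  have hkPlus : D₁.kObsPlus = D₂.kObsPlus := by
    have h₁ := D₁.kObsPlus_add_finrank_unobservable_inf_stableSubspace_neg
    rw [finrank_eq_of_homeomorph_mem_iff (V := _ ⊓ _) H fun x => and_congr (hobs x) (hunstable x),
      hPlus, ← D₂.kObsPlus_add_finrank_unobservable_inf_stableSubspace_neg] at h₁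
    exact Nat.add_right_cancel h₁
  have hn₁ := D₁.nZero_add_nPlus_add_nMinus
  have hn₂ := D₂.nZero_add_nPlus_add_nMinus
  have hk : D₁.kObsZero + (D₁.kObsPlus + D₁.kObsMinus) =
      D₂.kObsZero + (D₂.kObsPlus + D₂.kObsMinus) := by
    rw [← D₁.kObs_eq, ← D₂.kObs_eq, h.kObs_eq]
  lia

end Equivalence

end ObservedODE

theorem proposition1p2 {n p : ℕ}
    (A₁ A₂ : Matrix (Fin n) (Fin n) ℝ) (C₁ C₂ : Matrix (Fin p) (Fin n) ℝ)
    (h : ObservedODE.TopologicallyEquivalent A₁ C₁ A₂ C₂) :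
    Nonempty (ObservedODE.SpectralForm A₁ C₁) ∧ Nonempty (ObservedODE.SpectralForm A₂ C₂) ∧
    (∀ (D₁ : ObservedODE.SpectralForm A₁ C₁) (D₂ : ObservedODE.SpectralForm A₂ C₂),
      D₁.nZero = D₂.nZero ∧ D₁.nPlus = D₂.nPlus ∧ D₁.nMinus = D₂.nMinus ∧
      D₁.kObsZero = D₂.kObsZero ∧ D₁.kObsPlus = D₂.kObsPlus ∧ D₁.kObsMinus = D₂.kObsMinus) ∧
    ObservedODE.kObs A₁ C₁ = ObservedODE.kObs A₂ C₂ ∧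
    (ObservedODE.IsObservable A₁ C₁ ↔ ObservedODE.IsObservable A₂ C₂) ∧
    (ObservedODE.IsStable A₁ C₁ ↔ ObservedODE.IsStable A₂ C₂) := by
  obtain ⟨E₁⟩ := ObservedODE.nonempty_spectralForm A₁ C₁
  obtain ⟨E₂⟩ := ObservedODE.nonempty_spectralForm A₂ C₂
  refine ⟨⟨E₁⟩, ⟨E₂⟩, h.spectralForm_eq, h.kObs_eq, ?_, ?_, ?_⟩
  · rw [ObservedODE.IsObservable, ObservedODE.IsObservable, h.kObs_eq]
  · rintro ⟨D, hD⟩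
    exact ⟨E₂, (h.spectralForm_eq D E₂).2.2.1.symm.trans hD⟩
  · rintro ⟨D, hD⟩
    exact ⟨E₁, (h.spectralForm_eq E₁ D).2.2.1.trans hD⟩
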